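/- Let $K$ be a field with the discrete topology. A \emph{proartinian Hopf algebra} over $K$ is a topological $K$-vector space $H$ together with a base $\Lambda$ of neighbourhoods of $0$ consisting of open subspaces such that every quotient $H/U$ ($U\in\Lambda$) carries the structure of a finite dimensional Hopf $K$-algebra, the projections $H/U\to H/V$ ($U\subseteq V$ in $\Lambda$) are morphisms of Hopf algebras, and the natural map $H\to\varprojlim_{U\in\Lambda}H/U$ is bijective. The multiplication, unit and counit $\epsilon$ of $H$, and the comultiplication $h\mapsto h_{(1)}\otimes h_{(2)}$ with values in the completed tensor product $\varprojlim_{U,V}H/U\otimes H/V$, are the limits of those of the $H/U$. Let $H^\dagger=\varinjlim_{U\in\Lambda}(H/U)^*$ be the restricted dual, a Hopf algebra in the usual sense as a colimit of the dual Hopf algebras $(H/U)^*$, and let $\langle\cdot,\cdot\rangle:H\times H^\dagger\to K$ be the evaluation pairing. For a $K$-linear map $\rho:L\to L\otimes_K H^\dagger$, $\rho(x)=x_{[0]}\otimes x_{[1]}$, put $h\cdot x=x_{[0]}\langle h,x_{[1]}\rangle$. (1) For every $K$-vector space $L$, the assignment $\rho\mapsto\cdot$ is a bijection from the set of right $H^\dagger$-comodule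 structures $\rho$ on $L$ onto the set of left $H$-module structures on $L$, i.e. $K$-bilinear maps $H\times L\to L$, continuous for the discrete topology on $L$, with $1\cdot x=x$ and $(hk)\cdot x=h\cdot(k\cdot x)$. (2) For every (not necessarily commutative) $K$-algebra $L$, the same assignment is a bijection from the set of right $H^\dagger$-comodule algebra structures on $L$ onto the set of discrete left $H$-module algebra structures on $L$, i.e. module structures as in (1) with $h\cdot 1=\epsilon(h)1$ and $h\cdot(xy)=(h_{(1)}\cdot x)(h_{(2)}\cdot y)$. (3) Let $L/K$ be a field extension and let $\rho$ be an $H^\dagger$-comodule algebra structure on $L$ with corresponding $H$-action. For $U\in\Lambda$ put $L^U=\{x\in L: u\cdot x=0\text{ for all }u\in U\}$. Let $L\widehat\otimes_K H=\varprojlim_U L\otimes_K H/U$ and $\mathrm{End}_K(L)=\varprojlim_U\mathrm{Hom}_K(L^U,L)$ carry the limit topologies of the discrete topologies, and let $\mathrm{can}:L\widehat\otimes_K H\to\mathrm{End}_K(L)$ be the $L$-linear map induced by the maps $L\otimes_K H/U\to\mathrm{Hom}_K(L^U,L)$, $x\otimes\bar h\mapsto(y\mapsto x(h\cdot y))$.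 Then $L/K$ is $H$-Galois, i.e. $\mathrm{can}$ is a homeomorphism, if and only if $L/K$ is $H^\dagger$-Galois in the sense of Kreimer--Takeuchi, i.e. the map $\mathrm{can}^\dagger:L\otimes_K L\to L\otimes_K H^\dagger$, $x\otimes y\mapsto x\,y_{[0]}\otimes y_{[1]}$, is bijective. -/

import Mathlib

open scoped TensorProduct Topology
open Coalgebra

universe u v w

namespace HopfDual

section Pairing

variable {K M N : Type*} [Field K] [AddCommGroup M] [Module K M] [AddCommGroup N] [Module K N]

/-- The functional `p ⊗ q` on `M ⊗ N` attached to functionals `p` on `M` and `q` on `N`. -/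
noncomputable def pair (p : M →ₗ[K] K) (q : N →ₗ[K] K) : M ⊗[K] N →ₗ[K] K :=
  LinearMap.mul' K K ∘ₗ TensorProduct.map p q

@[simp] theorem pair_tmul (p : M →ₗ[K] K) (q : N →ₗ[K] K) (m : M) (n : N) :
    pair p q (m ⊗ₜ[K] n) = p m * q n := by
  simp [pair]

theorem pair_separating {I J : Type*} (p : I → M →ₗ[K] K) (q : J → N →ₗ[K] K)
    (hp : ∀ m, (∀ i, p i m = 0) → m = 0) (hq : ∀ n, (∀ j, q j n = 0) → n = 0)
    (z : M ⊗[K] N) (hz : ∀ i j, pair (p i) (q j) z = 0) : z = 0 := by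
  classical
  let b := Module.Basis.ofVectorSpace K N
  obtain ⟨c, rfl⟩ := TensorProduct.eq_repr_basis_right b z
  have key : ∀ s, c s = 0 := by
    intro s
    apply hp
    intro i
    have h0 : (c.sum fun s m => p i m • b s) = 0 := by
      apply hq
      intro j
      have := hz i j
      simp only [Finsupp.sum, map_sum, pair_tmul] at this
      simpa [Finsupp.sum, map_sum] using this
    by_cases hs : s ∈ c.support
    · exact (linearIndependent_iff'.1 b.linearIndependent) c.support (fun s => p i (c s)) h0 s hs
    · simp [Finsupp.notMem_support_iff.1 hs]
  simp [Finsupp.sum, key]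

theorem pair_ext {I J : Type*} (p : I → M →ₗ[K] K) (q : J → N →ₗ[K] K)
    (hp : ∀ m, (∀ i, p i m = 0) → m = 0) (hq : ∀ n, (∀ j, q j n = 0) → n = 0)
    (z w : M ⊗[K] N) (hz : ∀ i j, pair (p i) (q j) z = pair (p i) (q j) w) : z = w := by
  rw [← sub_eq_zero]
  exact pair_separating p q hp hq _ fun i j => by rw [map_sub, hz, sub_self]

end Pairing

section Dual

variable (K : Type*) [Field K]

/-- The dual space `A* = Hom(A, K)` of a bialgebra `A`. -/
def D (A : Type*) [Ring A] [Bialgebra K A] : Type _ := WithConv (A →ₗ[K] K)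

variable (A : Type*) [Ring A] [Bialgebra K A]

/-- The convolution product on `A*`, dual to the comultiplication of `A`. -/
noncomputable instance : Ring (D K A) := inferInstanceAs (Ring (WithConv (A →ₗ[K] K)))

noncomputable instance : Algebra K (D K A) := inferInstanceAs (Algebra K (WithConv (A →ₗ[K] K)))

variable {K A}

/-- Evaluation of functionals at a point. -/
def ev (a : A) : D K A →ₗ[K] K where
  toFun f := f.ofConv a
  map_add' _ _ := rfl
  map_smul' _ _ := rfl

variable (K A) in
/-- A linear functional on `A`, as an element of `A*`. -/
def ofDual : Module.Dual K A ≃ₗ[K] D K A where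
  toFun f := WithConv.toConv f
  map_add' _ _ := rfl
  map_smul' _ _ := rfl
  invFun f := f.ofConv
  left_inv _ := rfl
  right_inv _ := rfl

@[simp] theorem ev_ofDual (a : A) (f : Module.Dual K A) : ev a (ofDual K A f) = f a := rfl

theorem ofDual_symm_apply (a : A) (f : D K A) : (ofDual K A).symm f a = ev a f := rfl

theorem D_ext {f g : D K A} (h : ∀ a, ev (K := K) a f = ev a g) : f = g :=
  WithConv.ext (LinearMap.ext h)

theorem ev_separating (f : D K A) (h : ∀ a, ev (K := K) a f = 0) : f = 0 :=
  D_ext fun a => by rw [h, map_zero]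

theorem ev_add (a b : A) (f : D K A) : ev (a + b) f = ev a f + ev b f :=
  map_add f.ofConv a b

theorem ev_smul (c : K) (a : A) (f : D K A) : ev (c • a) f = c * ev a f :=
  map_smul f.ofConv c a

theorem ev_sum {ι : Type*} (s : Finset ι) (a : ι → A) (f : D K A) :
    ev (∑ i ∈ s, a i) f = ∑ i ∈ s, ev (a i) f :=
  map_sum f.ofConv a s

theorem ev_one (a : A) : ev (K := K) a 1 = counit a := rfl

theorem ev_mul {ι : Type*} (a : A) (r : Coalgebra.Repr K a ι) (f g : D K A) :
    ev a (f * g) = ∑ i ∈ r.index, ev (r.left i) f * ev (r.right i) g :=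
  Coalgebra.Repr.convMul_apply r f g

theorem extD2 (z w : D K A ⊗[K] D K A)
    (h : ∀ a b, pair (ev a) (ev b) z = pair (ev a) (ev b) w) : z = w :=
  pair_ext (fun a : A => ev a) (fun b : A => ev b) ev_separating ev_separating z w h

theorem extD3 (z w : D K A ⊗[K] (D K A ⊗[K] D K A))
    (h : ∀ a b c, pair (ev a) (pair (ev b) (ev c)) z = pair (ev a) (pair (ev b) (ev c)) w) :
    z = w :=
  pair_ext (fun a : A => ev a) (fun b : A × A => pair (ev b.1) (ev b.2)) ev_separating
    (fun n hn => pair_separating _ _ ev_separating ev_separating n fun i j => hn (i, j)) z w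
    fun a b => h a b.1 b.2

theorem pair_mul {ι κ : Type*} (a b : A) (r : Coalgebra.Repr K a ι) (r' : Coalgebra.Repr K b κ)
    (s t : D K A ⊗[K] D K A) :
    pair (ev a) (ev b) (s * t) = ∑ i ∈ r.index, ∑ j ∈ r'.index,
      pair (ev (r.left i)) (ev (r'.left j)) s * pair (ev (r.right i)) (ev (r'.right j)) t := by
  induction s with
  | zero => simp
  | add x y hx hy => simp only [add_mul, map_add, hx, hy, Finset.sum_add_distrib]
  | tmul f g =>
    induction t with
    | zero => simp
    | add x y hx hy => simp only [mul_add, map_add, hx, hy, Finset.sum_add_distrib]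
    | tmul f' g' =>
      simp only [Algebra.TensorProduct.tmul_mul_tmul, pair_tmul, ev_mul a r, ev_mul b r',
        Finset.sum_mul_sum]
      exact Finset.sum_congr rfl fun i _ => Finset.sum_congr rfl fun j _ => by ring

/-- The product of the chosen representatives of `comul a` and `comul b` represents
`comul (a * b)`. -/
def reprMul {ι κ : Type*} {a b : A} (r : Coalgebra.Repr K a ι) (r' : Coalgebra.Repr K b κ) :
    Coalgebra.Repr K (a * b) (ι × κ) where
  index := r.index ×ˢ r'.index
  left x := r.left x.1 * r'.left x.2
  right x := r.right x.1 * r'.right x.2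
  eq := by
    rw [Bialgebra.comul_mul, ← r.eq, ← r'.eq, Finset.sum_mul_sum, Finset.sum_product]
    simp

/-- The representative `1 ⊗ 1` of `comul 1`. -/
def reprOne : Coalgebra.Repr K (1 : A) Unit where
  index := {()}
  left _ := 1
  right _ := 1
  eq := by simp [Algebra.TensorProduct.one_def]

variable [Module.Finite K A]

variable (K A) in
/-- The comultiplication of `A*` dual to the multiplication of a finite dimensional `A`:
the composite `A* → (A ⊗ A)* ≅ A* ⊗ A*`. -/
noncomputable def comulD : D K A →ₗ[K] D K A ⊗[K] D K A :=
  (TensorProduct.congr (ofDual K A) (ofDual K A)).toLinearMap ∘ₗ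
    (TensorProduct.dualDistribEquiv K A A).symm.toLinearMap ∘ₗ
    (LinearMap.mul' K A).dualMap ∘ₗ (ofDual K A).symm.toLinearMap

theorem pair_comulD (a b : A) (f : D K A) :
    pair (ev a) (ev b) (comulD K A f) = ev (a * b) f := by
  have h : ∀ t : Module.Dual K A ⊗[K] Module.Dual K A,
      pair (ev (K := K) a) (ev b) (TensorProduct.congr (ofDual K A) (ofDual K A) t) =
      TensorProduct.dualDistribEquiv K A A t (a ⊗ₜ b) := by
    intro t
    induction t with
    | zero => simp
    | add x y hx hy => rw [map_add, map_add, hx, hy, map_add]; rfl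
    | tmul x y =>
      rw [TensorProduct.congr_tmul, pair_tmul]
      rfl
  unfold comulD
  simp only [LinearMap.comp_apply, LinearEquiv.coe_coe]
  rw [h, LinearEquiv.apply_symm_apply]
  simp [ofDual_symm_apply]

/-- The coalgebra structure on `A*` dual to the algebra structure of `A`. -/
noncomputable instance : Coalgebra K (D K A) where
  comul := comulD K A
  counit := ev 1
  coassoc := by
    refine LinearMap.ext fun f => ?_
    apply extD3
    intro a b c
    have h1 : ∀ t : D K A ⊗[K] D K A, pair (ev a) (pair (ev b) (ev c))
        (TensorProduct.assoc K _ _ _ ((comulD K A).rTensor (D K A) t)) =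
        pair (ev (a * b)) (ev c) t := by
      intro t
      induction t with
      | zero => simp
      | add x y hx hy => simp only [map_add, hx, hy]
      | tmul x y =>
        rw [LinearMap.rTensor_tmul, pair_tmul, ← pair_comulD]
        induction comulD K A x with
        | zero => simp
        | add x y hx hy => simp only [map_add, hx, hy, TensorProduct.add_tmul, add_mul]
        | tmul u v => simp [mul_assoc]
    have h2 : ∀ t : D K A ⊗[K] D K A, pair (ev a) (pair (ev b) (ev c))
        ((comulD K A).lTensor (D K A) t) = pair (ev a) (ev (b * c)) t := by
      intro t
      induction t with
      | zero => simp
      | add x y hx hy => simp only [map_add, hx, hy]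
      | tmul x y => rw [LinearMap.lTensor_tmul, pair_tmul, pair_tmul, pair_comulD]
    simp only [LinearMap.comp_apply, LinearEquiv.coe_coe, h1, h2, pair_comulD, mul_assoc]
  rTensor_counit_comp_comul := by
    refine LinearMap.ext fun f => (TensorProduct.lid K _).injective (D_ext fun a => ?_)
    have h : ∀ t : D K A ⊗[K] D K A,
        ev a (TensorProduct.lid K _ ((ev (K := K) (1 : A)).rTensor (D K A) t)) =
        pair (ev 1) (ev a) t := by
      intro t
      induction t with
      | zero => simp
      | add x y hx hy => simp only [map_add, ← hx, ← hy]
      | tmul x y => simp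
    simp [h, pair_comulD]
  lTensor_counit_comp_comul := by
    refine LinearMap.ext fun f => (TensorProduct.rid K _).injective (D_ext fun a => ?_)
    have h : ∀ t : D K A ⊗[K] D K A,
        ev a (TensorProduct.rid K _ ((ev (K := K) (1 : A)).lTensor (D K A) t)) =
        pair (ev a) (ev 1) t := by
      intro t
      induction t with
      | zero => simp
      | add x y hx hy => simp only [map_add, ← hx, ← hy]
      | tmul x y => simp [mul_comm]
    simp [h, pair_comulD]

theorem comul_eq (f : D K A) : comul (R := K) f = comulD K A f := rfl

theorem counit_eq (f : D K A) : counit (R := K) f = ev 1 f := rfl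

/-- The dual of a finite dimensional bialgebra is a bialgebra. -/
noncomputable instance : Bialgebra K (D K A) :=
  Bialgebra.mk' K (D K A)
    (by rw [counit_eq, ev_one, Bialgebra.counit_one])
    (by
      intro f g
      rw [counit_eq, counit_eq, counit_eq, ev_mul 1 reprOne]
      simp [reprOne])
    (by
      apply extD2
      intro a b
      rw [comul_eq, pair_comulD, ev_one, Bialgebra.counit_mul, Algebra.TensorProduct.one_def,
        pair_tmul, ev_one, ev_one])
    (by
      intro f g
      apply extD2
      intro a b
      rw [comul_eq, comul_eq, comul_eq, pair_comulD, pair_mul a b (ℛ K a) (ℛ K b),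
        ev_mul _ (reprMul (ℛ K a) (ℛ K b))]
      simp only [pair_comulD, reprMul, Finset.sum_product])

end Dual

section Hopf

variable {K : Type*} [Field K] {A B : Type*} [Ring A] [Ring B]

/-- The pullback of functionals along a bialgebra morphism, as an algebra morphism `B* → A*`. -/
noncomputable def mapD [Bialgebra K A] [Bialgebra K B] (φ : A →ₐc[K] B) : D K B →ₐ[K] D K A :=
  AlgHom.ofLinearMap
    ((ofDual K A).toLinearMap ∘ₗ (φ : A →ₗ[K] B).dualMap ∘ₗ (ofDual K B).symm.toLinearMap)
    (D_ext fun a => by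
      change ev (φ a) (1 : D K B) = ev a 1
      rw [ev_one, ev_one, CoalgHomClass.counit_comp_apply])
    (fun f g => D_ext fun a => by
      change ev (φ a) (f * g) = ev a (_ * _)
      rw [ev_mul a (ℛ K a), ev_mul (φ a) ((ℛ K a).induced φ)]
      rfl)

@[simp] theorem ev_mapD [Bialgebra K A] [Bialgebra K B] (φ : A →ₐc[K] B) (a : A) (f : D K B) :
    ev a (mapD φ f) = ev (φ a) f := rfl

theorem comulD_mapD [Bialgebra K A] [Bialgebra K B] [Module.Finite K A] [Module.Finite K B]
    (φ : A →ₐc[K] B) (f : D K B) :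
    comulD K A (mapD φ f) =
      TensorProduct.map (mapD φ).toLinearMap (mapD φ).toLinearMap (comulD K B f) := by
  apply extD2
  intro a b
  have h : ∀ t : D K B ⊗[K] D K B, pair (ev a) (ev b)
      (TensorProduct.map (mapD φ).toLinearMap (mapD φ).toLinearMap t) =
      pair (ev (φ a)) (ev (φ b)) t := by
    intro t
    induction t with
    | zero => simp
    | add x y hx hy => simp only [map_add, hx, hy]
    | tmul x y => simp
  rw [h, pair_comulD, pair_comulD, ev_mapD, map_mul]

/-- The dual of a finite dimensional Hopf algebra is a Hopf algebra; its antipode is the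
transpose of the antipode. -/
noncomputable instance [HopfAlgebra K A] [Module.Finite K A] : HopfAlgebra K (D K A) where
  antipode := (ofDual K A).toLinearMap ∘ₗ (HopfAlgebra.antipode K (A := A)).dualMap ∘ₗ
    (ofDual K A).symm.toLinearMap
  mul_antipode_rTensor_comul := by
    refine LinearMap.ext fun f => D_ext fun a => ?_
    have h : ∀ t : D K A ⊗[K] D K A, ev a (LinearMap.mul' K (D K A)
        (((ofDual K A).toLinearMap ∘ₗ (HopfAlgebra.antipode K (A := A)).dualMap ∘ₗ
          (ofDual K A).symm.toLinearMap).rTensor (D K A) t)) =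
        ∑ i ∈ (ℛ K a).index, pair (ev (HopfAlgebra.antipode K ((ℛ K a).left i)))
          (ev ((ℛ K a).right i)) t := by
      intro t
      induction t with
      | zero => simp
      | add x y hx hy => simp only [map_add, hx, hy, Finset.sum_add_distrib]
      | tmul x y =>
        simp only [LinearMap.rTensor_tmul, LinearMap.mul'_apply, ev_mul a (ℛ K a), pair_tmul]
        rfl
    simp only [LinearMap.comp_apply] at h ⊢
    rw [h]
    simp only [comul_eq, pair_comulD, ← ev_sum, HopfAlgebra.sum_antipode_mul_eq_algebraMap_counit]
    rw [counit_eq, Algebra.linearMap_apply, Algebra.algebraMap_eq_smul_one,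
      Algebra.algebraMap_eq_smul_one, ev_smul, map_smul, ev_one, smul_eq_mul, mul_comm]
  mul_antipode_lTensor_comul := by
    refine LinearMap.ext fun f => D_ext fun a => ?_
    have h : ∀ t : D K A ⊗[K] D K A, ev a (LinearMap.mul' K (D K A)
        (((ofDual K A).toLinearMap ∘ₗ (HopfAlgebra.antipode K (A := A)).dualMap ∘ₗ
          (ofDual K A).symm.toLinearMap).lTensor (D K A) t)) =
        ∑ i ∈ (ℛ K a).index, pair (ev ((ℛ K a).left i))
          (ev (HopfAlgebra.antipode K ((ℛ K a).right i))) t := by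
      intro t
      induction t with
      | zero => simp
      | add x y hx hy => simp only [map_add, hx, hy, Finset.sum_add_distrib]
      | tmul x y =>
        simp only [LinearMap.lTensor_tmul, LinearMap.mul'_apply, ev_mul a (ℛ K a), pair_tmul]
        rfl
    simp only [LinearMap.comp_apply] at h ⊢
    rw [h]
    simp only [comul_eq, pair_comulD, ← ev_sum, HopfAlgebra.sum_mul_antipode_eq_algebraMap_counit]
    rw [counit_eq, Algebra.linearMap_apply, Algebra.algebraMap_eq_smul_one,
      Algebra.algebraMap_eq_smul_one, ev_smul, map_smul, ev_one, smul_eq_mul, mul_comm]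

theorem map_antipode [HopfAlgebra K A] [HopfAlgebra K B] (φ : A →ₐc[K] B) (a : A) :
    φ (HopfAlgebra.antipode K a) = HopfAlgebra.antipode K (φ a) := by
  have h1 : WithConv.toConv (HopfAlgebra.antipode K (A := B) ∘ₗ (φ : A →ₗ[K] B)) *
      WithConv.toConv (φ : A →ₗ[K] B) = 1 := by
    ext x
    rw [(Coalgebra.Repr.convMul_apply (ℛ K x))]
    have := HopfAlgebra.sum_antipode_mul_eq_algebraMap_counit ((ℛ K x).induced φ)
    simpa using this
  have h2 : WithConv.toConv (φ : A →ₗ[K] B) *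
      WithConv.toConv ((φ : A →ₗ[K] B) ∘ₗ HopfAlgebra.antipode K (A := A)) = 1 := by
    ext x
    rw [(Coalgebra.Repr.convMul_apply (ℛ K x))]
    have := congrArg φ (HopfAlgebra.sum_mul_antipode_eq_algebraMap_counit (ℛ K x))
    rw [AlgHomClass.commutes] at this
    simpa using this
  have h := left_inv_eq_right_inv h1 h2
  exact (LinearMap.congr_fun (WithConv.toConv_injective h) a).symm

theorem antipode_mapD [HopfAlgebra K A] [HopfAlgebra K B] [Module.Finite K A] [Module.Finite K B]
    (φ : A →ₐc[K] B) (f : D K B) :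
    HopfAlgebra.antipode K (mapD φ f) = mapD φ (HopfAlgebra.antipode K f) := by
  refine D_ext fun a => ?_
  change ev (φ (HopfAlgebra.antipode K a)) f = ev (HopfAlgebra.antipode K (φ a)) f
  rw [map_antipode]

end Hopf

end HopfDual

/-- The structure of a proartinian Hopf algebra over `K` on a topological `K`-vector space `H`
(where `K` is discrete): a base `Λ` of neighbourhoods of `0` consisting of open subspaces, and for
each `U ∈ Λ` the structure of a finite dimensional Hopf algebra on the quotient space `H / U`, such
that the projections `H / U → H / V` for `U ≤ V` are morphisms of Hopf algebras and such that
the natural map from `H` to the projective limit of the `H / U` is bijective.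
The quotient space `H / U` is represented by `Q U`, together with the projection `proj U : H → Q U`,
a surjective linear map with kernel `U`.
The morphisms `trans` are uniquely determined by `trans_proj`; bialgebra morphisms between Hopf
algebras respect the antipodes. -/
structure ProartinianHopfAlgebra (K : Type u) (H : Type v) [Field K] [AddCommGroup H] [Module K H]
    [TopologicalSpace H] [IsTopologicalAddGroup H] where
  Λ : Set (Submodule K H)
  isOpen : ∀ U ∈ Λ, IsOpen (U : Set H)
  hasBasis : (𝓝 (0 : H)).HasBasis (fun U : Submodule K H => U ∈ Λ) (fun U => (U : Set H))
  Q : Λ → Type v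
  [ring : ∀ U, Ring (Q U)]
  [hopf : ∀ U, HopfAlgebra K (Q U)]
  [finite : ∀ U, Module.Finite K (Q U)]
  proj : ∀ U : Λ, H →ₗ[K] Q U
  proj_surjective : ∀ U, Function.Surjective (proj U)
  ker_proj : ∀ U : Λ, LinearMap.ker (proj U) = (U : Submodule K H)
  trans : ∀ {U V : Λ}, U ≤ V → Q U →ₐc[K] Q V
  trans_proj : ∀ {U V : Λ} (h : U ≤ V) (x : H), trans h (proj U x) = proj V x
  complete : ∀ q : (∀ U : Λ, Q U), (∀ (U V : Λ) (h : U ≤ V), trans h (q U) = q V) →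
    ∃! x : H, ∀ U, proj U x = q U

namespace ProartinianHopfAlgebra

attribute [instance] ring hopf finite

variable {K : Type u} {H : Type v} [Field K] [AddCommGroup H] [Module K H]
  [TopologicalSpace H] [IsTopologicalAddGroup H] (P : ProartinianHopfAlgebra K H)

theorem exists_le_le (U V : P.Λ) : ∃ W : P.Λ, W ≤ U ∧ W ≤ V := by
  have h := Filter.inter_mem (P.hasBasis.mem_of_mem U.2) (P.hasBasis.mem_of_mem V.2)
  obtain ⟨W, hW, hs⟩ := P.hasBasis.mem_iff.1 h
  exact ⟨⟨W, hW⟩, fun x hx => (hs hx).1, fun x hx => (hs hx).2⟩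

instance : Nonempty P.Λ := by
  obtain ⟨W, hW, -⟩ := P.hasBasis.mem_iff.1 Filter.univ_mem
  exact ⟨⟨W, hW⟩⟩

instance : IsDirectedOrder (P.Λ)ᵒᵈ where
  directed U V := P.exists_le_le U.ofDual V.ofDual

theorem proj_eq_zero {U : P.Λ} {x : H} : P.proj U x = 0 ↔ x ∈ (U : Submodule K H) := by
  rw [← P.ker_proj U, LinearMap.mem_ker]

theorem proj_ext {x y : H} (h : ∀ U, P.proj U x = P.proj U y) : x = y := by
  obtain ⟨z, -, hz⟩ := P.complete (fun U => P.proj U y) (fun _ _ h => P.trans_proj h y)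
  rw [hz x h, hz y fun _ => rfl]

/-! ### The multiplication and the unit of `H` -/

/-- The multiplication of `H`, the projective limit of the multiplications of the `H / U`. -/
noncomputable def mul (x y : H) : H :=
  (P.complete (fun U => P.proj U x * P.proj U y) fun _ _ _ => by
    rw [map_mul, P.trans_proj, P.trans_proj]).choose

theorem proj_mul (U : P.Λ) (x y : H) : P.proj U (P.mul x y) = P.proj U x * P.proj U y :=
  (P.complete (fun U => P.proj U x * P.proj U y) fun _ _ _ => by
    rw [map_mul, P.trans_proj, P.trans_proj]).choose_spec.1 U

/-- The unit element of `H`, given by the unit elements of the `H / U`. -/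
noncomputable def one : H :=
  (P.complete (fun _ => 1) fun _ _ _ => map_one _).choose

theorem proj_one (U : P.Λ) : P.proj U P.one = 1 :=
  (P.complete (fun _ => 1) fun _ _ _ => map_one _).choose_spec.1 U

/-! ### The restricted dual -/

open HopfDual

theorem trans_refl (U : P.Λ) (q : P.Q U) : P.trans (le_refl U) q = q := by
  obtain ⟨x, rfl⟩ := P.proj_surjective U q
  exact P.trans_proj _ x

theorem trans_trans {U V W : P.Λ} (h : U ≤ V) (h' : V ≤ W) (q : P.Q U) :
    P.trans h' (P.trans h q) = P.trans (h.trans h') q := by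
  obtain ⟨x, rfl⟩ := P.proj_surjective U q
  simp only [P.trans_proj]

/-- The transition morphisms `(H / V)* → (H / U)*` for `U ≤ V`. -/
noncomputable def transD (V U : (P.Λ)ᵒᵈ) (h : V ≤ U) :
    D K (P.Q V.ofDual) →ₐ[K] D K (P.Q U.ofDual) :=
  mapD (P.trans (U := U.ofDual) (V := V.ofDual) h)

instance : DirectedSystem (fun U : (P.Λ)ᵒᵈ => D K (P.Q U.ofDual)) (P.transD · · ·) where
  map_self U f := D_ext fun a => by
    change ev (P.trans _ a) f = ev a f
    rw [trans_refl]
  map_map U V W h h' f := D_ext fun a => by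
    exact congrArg (fun q => ev q f) (P.trans_trans h' h a)

/-- The restricted dual `H† = colim (H / U)*`, with the induced algebra structure. -/
def RestrictedDual : Type (max u v) :=
  DirectLimit (fun U : (P.Λ)ᵒᵈ => D K (P.Q U.ofDual)) P.transD

noncomputable instance : Ring P.RestrictedDual :=
  inferInstanceAs (Ring (DirectLimit (fun U : (P.Λ)ᵒᵈ => D K (P.Q U.ofDual)) P.transD))

noncomputable instance : Module K P.RestrictedDual :=
  inferInstanceAs (Module K (DirectLimit (fun U : (P.Λ)ᵒᵈ => D K (P.Q U.ofDual)) P.transD))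

instance : IsScalarTower K P.RestrictedDual P.RestrictedDual :=
  inferInstanceAs (IsScalarTower K
    (DirectLimit (fun U : (P.Λ)ᵒᵈ => D K (P.Q U.ofDual)) P.transD)
    (DirectLimit (fun U : (P.Λ)ᵒᵈ => D K (P.Q U.ofDual)) P.transD))

instance : SMulCommClass K P.RestrictedDual P.RestrictedDual :=
  inferInstanceAs (SMulCommClass K
    (DirectLimit (fun U : (P.Λ)ᵒᵈ => D K (P.Q U.ofDual)) P.transD)
    (DirectLimit (fun U : (P.Λ)ᵒᵈ => D K (P.Q U.ofDual)) P.transD))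

noncomputable instance : Algebra K P.RestrictedDual :=
  Algebra.ofModule smul_mul_assoc mul_smul_comm

/-- The canonical morphism `(H / U)* → H†`. -/
noncomputable def ι (U : P.Λ) : D K (P.Q U) →ₐ[K] P.RestrictedDual :=
  AlgHom.ofLinearMap
    { toFun := fun f => (⟦⟨OrderDual.toDual U, f⟩⟧ :
        DirectLimit (fun U : (P.Λ)ᵒᵈ => D K (P.Q U.ofDual)) P.transD)
      map_add' := fun _ _ => (DirectLimit.add_def _ _ _).symm
      map_smul' := fun _ _ => (DirectLimit.smul_def _ _ _).symm }
    (DirectLimit.one_def _).symm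
    (fun _ _ => (DirectLimit.mul_def _ _ _).symm)

theorem ι_trans {U V : P.Λ} (h : U ≤ V) (f : D K (P.Q V)) :
    P.ι U (mapD (P.trans h) f) = P.ι V f :=
  (DirectLimit.eq_of_le (F := fun U : (P.Λ)ᵒᵈ => D K (P.Q U.ofDual)) (f := P.transD)
    ⟨OrderDual.toDual V, f⟩ (OrderDual.toDual U) h).symm

theorem exists_ι (z : P.RestrictedDual) : ∃ (U : P.Λ) (f : D K (P.Q U)), z = P.ι U f := by
  obtain ⟨i, x, h⟩ := DirectLimit.exists_eq_mk P.transD z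
  exact ⟨i.ofDual, x, h⟩

theorem exists_ι₂ (z w : P.RestrictedDual) :
    ∃ (U : P.Λ) (f g : D K (P.Q U)), z = P.ι U f ∧ w = P.ι U g := by
  obtain ⟨i, x, y, h, h'⟩ := DirectLimit.exists_eq_mk₂ P.transD z w
  exact ⟨i.ofDual, x, y, h, h'⟩

/-- The universal property of the colimit `H†`. -/
noncomputable def liftD {M : Type*} [AddCommGroup M] [Module K M]
    (g : ∀ U : P.Λ, D K (P.Q U) →ₗ[K] M)
    (hg : ∀ (U V : P.Λ) (h : U ≤ V) (f : D K (P.Q V)), g U (mapD (P.trans h) f) = g V f) :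
    P.RestrictedDual →ₗ[K] M :=
  let φ : P.RestrictedDual → M := DirectLimit.lift P.transD (fun U => g U.ofDual)
    fun V U h f => (hg U.ofDual V.ofDual h f).symm
  have hφ : ∀ U f, φ (P.ι U f) = g U f := fun _ _ => rfl
  { toFun := φ
    map_add' := fun x y => by
      obtain ⟨U, f, f', rfl, rfl⟩ := P.exists_ι₂ x y
      rw [← map_add, hφ, hφ, hφ, map_add]
    map_smul' := fun r x => by
      obtain ⟨U, f, rfl⟩ := P.exists_ι x
      rw [← map_smul, hφ, hφ, map_smul, RingHom.id_apply] }

@[simp] theorem liftD_ι {M : Type*} [AddCommGroup M] [Module K M]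
    (g : ∀ U : P.Λ, D K (P.Q U) →ₗ[K] M)
    (hg : ∀ (U V : P.Λ) (h : U ≤ V) (f : D K (P.Q V)), g U (mapD (P.trans h) f) = g V f)
    (U : P.Λ) (f : D K (P.Q U)) : P.liftD g hg (P.ι U f) = g U f := rfl

/-- The comultiplication of `H†`, the colimit of the comultiplications of the `(H / U)*`. -/
noncomputable def comulR : P.RestrictedDual →ₗ[K] P.RestrictedDual ⊗[K] P.RestrictedDual :=
  P.liftD (fun U => TensorProduct.map (P.ι U).toLinearMap (P.ι U).toLinearMap ∘ₗ comul)
    fun U V h f => by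
      simp only [LinearMap.comp_apply, comul_eq, comulD_mapD]
      rw [← LinearMap.comp_apply, ← TensorProduct.map_comp]
      congr 2 <;> exact LinearMap.ext fun g => P.ι_trans h g

theorem comulR_ι (U : P.Λ) (f : D K (P.Q U)) : P.comulR (P.ι U f) =
    TensorProduct.map (P.ι U).toLinearMap (P.ι U).toLinearMap (comul f) := rfl

/-- The counit of `H†`, the colimit of the counits of the `(H / U)*`. -/
noncomputable def counitR : P.RestrictedDual →ₗ[K] K :=
  P.liftD (fun _ => counit) fun U V h f => by
    rw [counit_eq, counit_eq, ev_mapD, map_one]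

theorem counitR_ι (U : P.Λ) (f : D K (P.Q U)) : P.counitR (P.ι U f) = counit f := rfl

/-- The antipode of `H†`, the colimit of the antipodes of the `(H / U)*`. -/
noncomputable def antipodeR : P.RestrictedDual →ₗ[K] P.RestrictedDual :=
  P.liftD (fun U => (P.ι U).toLinearMap ∘ₗ HopfAlgebra.antipode K) fun U V h f => by
    simp only [LinearMap.comp_apply, antipode_mapD]
    exact P.ι_trans h _

theorem antipodeR_ι (U : P.Λ) (f : D K (P.Q U)) :
    P.antipodeR (P.ι U f) = P.ι U (HopfAlgebra.antipode K f) := rfl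

noncomputable instance : Coalgebra K P.RestrictedDual where
  comul := P.comulR
  counit := P.counitR
  coassoc := by
    refine LinearMap.ext fun z => ?_
    obtain ⟨U, f, rfl⟩ := P.exists_ι z
    have h1 : ∀ t : D K (P.Q U) ⊗[K] D K (P.Q U), P.comulR.rTensor P.RestrictedDual
        (TensorProduct.map (P.ι U).toLinearMap (P.ι U).toLinearMap t) =
        TensorProduct.map (TensorProduct.map (P.ι U).toLinearMap (P.ι U).toLinearMap)
          (P.ι U).toLinearMap (comul.rTensor _ t) := by
      intro t
      induction t with
      | zero => simp
      | add x y hx hy => simp only [map_add, hx, hy]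
      | tmul x y => simp [comulR_ι]
    have h2 : ∀ t : D K (P.Q U) ⊗[K] D K (P.Q U), P.comulR.lTensor P.RestrictedDual
        (TensorProduct.map (P.ι U).toLinearMap (P.ι U).toLinearMap t) =
        TensorProduct.map (P.ι U).toLinearMap
          (TensorProduct.map (P.ι U).toLinearMap (P.ι U).toLinearMap) (comul.lTensor _ t) := by
      intro t
      induction t with
      | zero => simp
      | add x y hx hy => simp only [map_add, hx, hy]
      | tmul x y => simp [comulR_ι]
    simp only [LinearMap.comp_apply, LinearEquiv.coe_coe, comulR_ι]
    rw [h1, h2, ← Coalgebra.coassoc_apply, TensorProduct.map_map_assoc]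
  rTensor_counit_comp_comul := by
    refine LinearMap.ext fun z => ?_
    obtain ⟨U, f, rfl⟩ := P.exists_ι z
    have h1 : ∀ t : D K (P.Q U) ⊗[K] D K (P.Q U), P.counitR.rTensor P.RestrictedDual
        (TensorProduct.map (P.ι U).toLinearMap (P.ι U).toLinearMap t) =
        (P.ι U).toLinearMap.lTensor K (counit.rTensor _ t) := by
      intro t
      induction t with
      | zero => simp
      | add x y hx hy => simp only [map_add, hx, hy]
      | tmul x y => simp [counitR_ι]
    simp only [LinearMap.comp_apply, comulR_ι]
    rw [h1, Coalgebra.rTensor_counit_comul]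
    simp
  lTensor_counit_comp_comul := by
    refine LinearMap.ext fun z => ?_
    obtain ⟨U, f, rfl⟩ := P.exists_ι z
    have h1 : ∀ t : D K (P.Q U) ⊗[K] D K (P.Q U), P.counitR.lTensor P.RestrictedDual
        (TensorProduct.map (P.ι U).toLinearMap (P.ι U).toLinearMap t) =
        (P.ι U).toLinearMap.rTensor K (counit.lTensor _ t) := by
      intro t
      induction t with
      | zero => simp
      | add x y hx hy => simp only [map_add, hx, hy]
      | tmul x y => simp [counitR_ι]
    simp only [LinearMap.comp_apply, comulR_ι]
    rw [h1, Coalgebra.lTensor_counit_comul]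
    simp

noncomputable instance : Bialgebra K P.RestrictedDual :=
  Bialgebra.mk' K P.RestrictedDual
    (by
      obtain ⟨U⟩ := (inferInstance : Nonempty P.Λ)
      rw [← map_one (P.ι U)]
      exact Bialgebra.counit_one)
    (by
      intro x y
      obtain ⟨U, f, g, rfl, rfl⟩ := P.exists_ι₂ x y
      rw [← map_mul]
      exact Bialgebra.counit_mul f g)
    (by
      obtain ⟨U⟩ := (inferInstance : Nonempty P.Λ)
      rw [← map_one (P.ι U)]
      change P.comulR _ = _
      rw [comulR_ι, Bialgebra.comul_one, Algebra.TensorProduct.one_def,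
        Algebra.TensorProduct.one_def]
      simp)
    (by
      intro x y
      obtain ⟨U, f, g, rfl, rfl⟩ := P.exists_ι₂ x y
      rw [← map_mul]
      change P.comulR _ = P.comulR _ * P.comulR _
      rw [comulR_ι, comulR_ι, comulR_ι, Bialgebra.comul_mul]
      exact map_mul (Algebra.TensorProduct.map (P.ι U) (P.ι U)) (comul f) (comul g))

/-- The restricted dual of a proartinian Hopf algebra is a Hopf algebra. -/
noncomputable instance : HopfAlgebra K P.RestrictedDual where
  antipode := P.antipodeR
  mul_antipode_rTensor_comul := by
    refine LinearMap.ext fun z => ?_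
    obtain ⟨U, f, rfl⟩ := P.exists_ι z
    have h1 : ∀ t : D K (P.Q U) ⊗[K] D K (P.Q U), LinearMap.mul' K P.RestrictedDual
        (P.antipodeR.rTensor P.RestrictedDual
        (TensorProduct.map (P.ι U).toLinearMap (P.ι U).toLinearMap t)) =
        P.ι U (LinearMap.mul' K _ ((HopfAlgebra.antipode K).rTensor _ t)) := by
      intro t
      induction t with
      | zero => simp
      | add x y hx hy => simp only [map_add, hx, hy]
      | tmul x y => simp [antipodeR_ι]
    change LinearMap.mul' K _ (P.antipodeR.rTensor _ (P.comulR _)) =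
      algebraMap K _ (P.counitR _)
    rw [comulR_ι, counitR_ι, h1, HopfAlgebra.mul_antipode_rTensor_comul_apply, AlgHom.commutes]
  mul_antipode_lTensor_comul := by
    refine LinearMap.ext fun z => ?_
    obtain ⟨U, f, rfl⟩ := P.exists_ι z
    have h1 : ∀ t : D K (P.Q U) ⊗[K] D K (P.Q U), LinearMap.mul' K P.RestrictedDual
        (P.antipodeR.lTensor P.RestrictedDual
        (TensorProduct.map (P.ι U).toLinearMap (P.ι U).toLinearMap t)) =
        P.ι U (LinearMap.mul' K _ ((HopfAlgebra.antipode K).lTensor _ t)) := by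
      intro t
      induction t with
      | zero => simp
      | add x y hx hy => simp only [map_add, hx, hy]
      | tmul x y => simp [antipodeR_ι]
    change LinearMap.mul' K _ (P.antipodeR.lTensor _ (P.comulR _)) =
      algebraMap K _ (P.counitR _)
    rw [comulR_ι, counitR_ι, h1, HopfAlgebra.mul_antipode_lTensor_comul_apply, AlgHom.commutes]

/-- The pairing `H × H† → K` induced by the evaluation pairings `H / U × (H / U)* → K`. -/
noncomputable def eval : H →ₗ[K] P.RestrictedDual →ₗ[K] K where
  toFun x := P.liftD (fun U => ev (P.proj U x)) fun U V h f => by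
    rw [ev_mapD, trans_proj]
  map_add' x y := LinearMap.ext fun z => by
    obtain ⟨U, f, rfl⟩ := P.exists_ι z
    simp [ev_add]
  map_smul' c x := LinearMap.ext fun z => by
    obtain ⟨U, f, rfl⟩ := P.exists_ι z
    simp [ev_smul]

@[simp] theorem eval_ι (x : H) (U : P.Λ) (f : D K (P.Q U)) :
    P.eval x (P.ι U f) = ev (P.proj U x) f := rfl

/-! ### Discrete modules and module algebras -/

section Actions

variable {P}
variable {L : Type w} [AddCommGroup L] [Module K L] (α : H →ₗ[K] L →ₗ[K] L)

variable (P) in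
/-- The bilinear map `α : H × L → L`, `(h, x) ↦ h · x`, turns the discrete vector space `L` into a
left `H`-module. -/
structure IsDiscreteModule : Prop where
  continuous : letI : TopologicalSpace L := ⊥; Continuous fun p : H × L => α p.1 p.2
  one_act : ∀ x, α P.one x = x
  mul_act : ∀ h k x, α (P.mul h k) x = α h (α k x)

variable (P) in
/-- The subspace `L^U` of elements annihilated by `U`. -/
def fixed (U : P.Λ) : Submodule K L where
  carrier := {x | ∀ h ∈ (U : Submodule K H), α h x = 0}
  add_mem' hx hy h hh := by rw [map_add, hx h hh, hy h hh, add_zero]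
  zero_mem' h _ := map_zero _
  smul_mem' c x hx h hh := by rw [map_smul, hx h hh, smul_zero]

variable (P) in
theorem fixed_mono {U V : P.Λ} (h : U ≤ V) : P.fixed α V ≤ P.fixed α U :=
  fun _ hx k hk => hx k (h hk)

variable (P) in
/-- The map `H / U × L^U → L` induced by the action of `H` on `L`. -/
noncomputable def act (U : P.Λ) : P.Q U →ₗ[K] P.fixed α U →ₗ[K] L :=
  Submodule.liftQ (LinearMap.ker (P.proj U)) ((LinearMap.lcomp K L (P.fixed α U).subtype) ∘ₗ α)
    (by
      rw [P.ker_proj]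
      intro h hh
      rw [LinearMap.mem_ker]
      exact LinearMap.ext fun x => x.2 h hh) ∘ₗ
    ((P.proj U).quotKerEquivOfSurjective (P.proj_surjective U)).symm.toLinearMap

variable (P) in
theorem act_proj (U : P.Λ) (h : H) (x : P.fixed α U) : P.act α U (P.proj U h) x = α h x := by
  simp [act, LinearMap.quotKerEquivOfSurjective_symm_apply]

theorem IsDiscreteModule.exists_mem_fixed {α : H →ₗ[K] L →ₗ[K] L} (hα : P.IsDiscreteModule α)
    (x : L) : ∃ U, x ∈ P.fixed α U := by
  let _ : TopologicalSpace L := ⊥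
  have : DiscreteTopology L := ⟨rfl⟩
  have hc : Continuous fun h : H => α h x :=
    (show Continuous fun p : H × L => α p.1 p.2 from hα.continuous).comp
      (Continuous.prodMk_left x)
  have ho : (fun h : H => α h x) ⁻¹' {0} ∈ 𝓝 (0 : H) :=
    (hc.isOpen_preimage _ (isOpen_discrete _)).mem_nhds (by simp)
  obtain ⟨U, hU, hs⟩ := P.hasBasis.mem_iff.1 ho
  exact ⟨⟨U, hU⟩, fun h hh => hs hh⟩

end Actions

section ModuleAlgebra

variable {L : Type w} [Ring L] [Algebra K L]

/-- The bilinear map `α : H × L → L`, `(h, x) ↦ h · x`, turns the discrete `K`-algebra `L` into a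
left `H`-module algebra: `h · 1 = ε(h) 1` and `h · (x y) = (h₁ · x) (h₂ · y)`. The counit `ε` of `H`
and its comultiplication `Δ h = h₁ ⊗ h₂`, with values in the completed tensor product of `H` with
itself, are the projective limits of those of the quotients `H / U`; for `x` and `y` in `L^U`, the
right hand side of the second condition only depends on the component in `H / U ⊗ H / U` of `Δ h`,
which is the comultiplication of the class of `h` in `H / U`. -/
structure IsDiscreteModuleAlgebra (α : H →ₗ[K] L →ₗ[K] L) : Prop extends P.IsDiscreteModule α where
  act_one : ∀ (U : P.Λ) (h : H), α h 1 = algebraMap K L (counit (P.proj U h))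
  act_mul : ∀ (U : P.Λ) (h : H) (x y : P.fixed α U), α h (x * y) =
    LinearMap.mul' K L (TensorProduct.map ((P.act α U).flip x) ((P.act α U).flip y)
      (comul (P.proj U h)))

end ModuleAlgebra

/-! ### Hopf-Galois extensions for actions -/

section Galois

variable (L : Type w) [Field L] [Algebra K L]

/-- The completed tensor product `L ^⊗ H` of `L` and `H`, the projective limit of the `L ⊗ H / U`. -/
def CompletedTensor : Submodule L (∀ U : P.Λ, L ⊗[K] P.Q U) where
  carrier := {z | ∀ (U V : P.Λ) (h : U ≤ V),
    (P.trans h : P.Q U →ₗ[K] P.Q V).baseChange L (z U) = z V}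
  add_mem' hx hy U V h := by rw [Pi.add_apply, Pi.add_apply, map_add, hx U V h, hy U V h]
  zero_mem' U V h := map_zero _
  smul_mem' c x hx U V h := by rw [Pi.smul_apply, Pi.smul_apply, map_smul, hx U V h]

/-- The projective limit topology on `L ^⊗ H`, all `L ⊗ H / U` being discrete. -/
instance : TopologicalSpace (P.CompletedTensor L) :=
  ⨅ U : P.Λ, TopologicalSpace.induced (fun z => z.1 U) ⊥

variable {L} (α : H →ₗ[K] L →ₗ[K] L)

/-- The topology on `End(L)` as the projective limit of the discrete spaces `Hom(L^U, L)`,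
via the restriction maps. -/
abbrev endTopology : TopologicalSpace (L →ₗ[K] L) :=
  ⨅ U : P.Λ, TopologicalSpace.induced (fun f => f.domRestrict (P.fixed α U)) ⊥

/-- The canonical map `L ⊗ H / U → Hom(L^U, L)`, `x ⊗ q ↦ (y ↦ x (q · y))`. -/
noncomputable def canQ (U : P.Λ) : L ⊗[K] P.Q U →ₗ[L] P.fixed α U →ₗ[K] L :=
  TensorProduct.AlgebraTensorModule.lift (LinearMap.toSpanSingleton L _ (P.act α U))

@[simp] theorem canQ_tmul (U : P.Λ) (x : L) (q : P.Q U) (y : P.fixed α U) :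
    P.canQ α U (x ⊗ₜ q) y = x * P.act α U q y := rfl

theorem canQ_trans {U V : P.Λ} (h : U ≤ V) (t : L ⊗[K] P.Q U) (y : P.fixed α V) :
    P.canQ α V ((P.trans h : P.Q U →ₗ[K] P.Q V).baseChange L t) y =
      P.canQ α U t ⟨y, P.fixed_mono α h y.2⟩ := by
  induction t with
  | zero => simp
  | add a b ha hb => simp only [map_add, LinearMap.add_apply, ha, hb]
  | tmul x q =>
    obtain ⟨k, rfl⟩ := P.proj_surjective U q
    rw [LinearMap.baseChange_tmul, canQ_tmul, canQ_tmul, act_proj]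
    change _ * P.act α V (P.trans h (P.proj U k)) y = _
    rw [trans_proj, act_proj]

variable {P α}

theorem canQ_congr (z : P.CompletedTensor L) (U V : P.Λ) (y : L) (hU : y ∈ P.fixed α U)
    (hV : y ∈ P.fixed α V) : P.canQ α U (z.1 U) ⟨y, hU⟩ = P.canQ α V (z.1 V) ⟨y, hV⟩ := by
  obtain ⟨W, hWU, hWV⟩ := P.exists_le_le U V
  rw [← z.2 W U hWU, ← z.2 W V hWV, canQ_trans, canQ_trans]

/-- The canonical map `can : L ^⊗ H → End(L)`, the map whose composite with each
restriction `End(L) → Hom(L^U, L)` is `L ^⊗ H → L ⊗ H / U → Hom(L^U, L)`. -/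
noncomputable def can (hα : P.IsDiscreteModule α) : P.CompletedTensor L →ₗ[L] L →ₗ[K] L where
  toFun z :=
    { toFun := fun y => P.canQ α (hα.exists_mem_fixed y).choose
        (z.1 (hα.exists_mem_fixed y).choose) ⟨y, (hα.exists_mem_fixed y).choose_spec⟩
      map_add' := fun x y => by
        obtain ⟨W, hWx, hWy⟩ := P.exists_le_le (hα.exists_mem_fixed x).choose
          (hα.exists_mem_fixed y).choose
        have hx := P.fixed_mono α hWx (hα.exists_mem_fixed x).choose_spec
        have hy := P.fixed_mono α hWy (hα.exists_mem_fixed y).choose_spec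
        rw [canQ_congr z _ W x _ hx, canQ_congr z _ W y _ hy,
          canQ_congr z _ W (x + y) _ (add_mem hx hy), ← map_add]
        rfl
      map_smul' := fun c x => by
        have hx := (hα.exists_mem_fixed x).choose_spec
        rw [canQ_congr z _ _ (c • x) _ (Submodule.smul_mem _ c hx), RingHom.id_apply, ← map_smul]
        rfl }
  map_add' z w := LinearMap.ext fun y => by
    simp
  map_smul' c z := LinearMap.ext fun y => by
    simp

theorem can_apply (hα : P.IsDiscreteModule α) (z : P.CompletedTensor L) (U : P.Λ)
    (y : P.fixed α U) : can hα z y = P.canQ α U (z.1 U) y :=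
  canQ_congr z _ U y _ y.2

variable (P) in
/-- The extension `L / K` is `H`-Galois with respect to the action `α` of `H` on `L`. -/
def IsHGalois (α : H →ₗ[K] L →ₗ[K] L) : Prop :=
  ∃ hα : P.IsDiscreteModuleAlgebra α,
    letI := P.endTopology α
    IsHomeomorph (can hα.toIsDiscreteModule)

end Galois

end ProartinianHopfAlgebra

/-! ### Comodules and comodule algebras -/

section Comodules

variable {K : Type u} [Field K] {C : Type v} {L : Type w}

/-- The linear map `ρ` turns `L` into a right comodule over the coalgebra `C`. -/
structure IsComodule [AddCommGroup C] [Module K C] [Coalgebra K C] [AddCommGroup L] [Module K L]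
    (ρ : L →ₗ[K] L ⊗[K] C) : Prop where
  coassoc : (TensorProduct.assoc K L C C).toLinearMap ∘ₗ ρ.rTensor C ∘ₗ ρ = comul.lTensor L ∘ₗ ρ
  counit : (TensorProduct.rid K L).toLinearMap ∘ₗ counit.lTensor L ∘ₗ ρ = LinearMap.id

/-- The linear map `ρ` turns the algebra `L` into a right comodule algebra over the
bialgebra `C`. -/
structure IsComoduleAlgebra [Ring C] [Bialgebra K C] [Ring L] [Algebra K L]
    (ρ : L →ₗ[K] L ⊗[K] C) : Prop extends IsComodule ρ where
  map_one : ρ 1 = 1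
  map_mul : ∀ x y, ρ (x * y) = ρ x * ρ y

/-- The canonical map `L ⊗ L → L ⊗ C`, `x ⊗ y ↦ x y₀ ⊗ y₁`, of a coaction
`ρ : y ↦ y₀ ⊗ y₁` of `C` on `L`. -/
noncomputable def coactionCan [Ring C] [Bialgebra K C] [Field L] [Algebra K L]
    (ρ : L →ₗ[K] L ⊗[K] C) : L ⊗[K] L →ₗ[L] L ⊗[K] C :=
  TensorProduct.AlgebraTensorModule.lift (LinearMap.toSpanSingleton L _ ρ)

end Comodules

namespace ProartinianHopfAlgebra

/-- The action `h · x = x₀ ⟨h, x₁⟩` of `H` on `L` attached to a linear map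
`ρ : L → L ⊗ H†`, `x ↦ x₀ ⊗ x₁`. -/
noncomputable def actionOfCoaction {K : Type u} {H : Type v} [Field K] [AddCommGroup H] [Module K H]
    [TopologicalSpace H] [IsTopologicalAddGroup H] (P : ProartinianHopfAlgebra K H)
    {L : Type w} [AddCommGroup L] [Module K L] (ρ : L →ₗ[K] L ⊗[K] P.RestrictedDual) :
    H →ₗ[K] L →ₗ[K] L :=
  LinearMap.lcomp K L ρ ∘ₗ LinearMap.compRight K (TensorProduct.rid K L).toLinearMap ∘ₗ
    LinearMap.lTensorHom L ∘ₗ P.eval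

theorem actionOfCoaction_apply {K : Type u} {H : Type v} [Field K] [AddCommGroup H] [Module K H]
    [TopologicalSpace H] [IsTopologicalAddGroup H] (P : ProartinianHopfAlgebra K H)
    {L : Type w} [AddCommGroup L] [Module K L] (ρ : L →ₗ[K] L ⊗[K] P.RestrictedDual)
    (h : H) (x : L) :
    P.actionOfCoaction ρ h x = TensorProduct.rid K L ((P.eval h).lTensor L (ρ x)) := rfl

end ProartinianHopfAlgebra

/-! The key device is contraction: a functional on `N` gives a map `L ⊗ N → L`, and if a family of
functionals separates the points of `N`, the corresponding contractions separate the points of `L ⊗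
N`. The functionals `⟨h, ·⟩` separate the points of `H†`, and their products separate those of `H† ⊗
H†`. Hence a coaction is determined by its action, and each comodule axiom can be tested after
contraction, where it becomes a module axiom because the structure maps of `H†` are dual to those of
`H`.

The two finiteness conditions also match. A tensor in `L ⊗ H†` involves finitely many functionals,
all defined on one `H / U`, so `U` kills it; this is continuity of the action. Conversely,
continuity puts `x` in some `L^U`, and since `H / U` is finite dimensional, the map `q ↦ q · x` in
`Hom(H / U, L)` is an element of `L ⊗ (H / U)*`, whose image in `L ⊗ H†` is `ρ(x)`. For module
algebras, two elements are placed in a common `L^U`, where multiplication in `(H / U)*` is dual to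
the comultiplication of `H / U`.

For the Galois condition, `L ^⊗ H = lim Hom_K((H / U)*, L) = Hom_K(H†, L)` is the `L`-dual of `L ⊗
H†`, while `End_K(L)` is the `L`-dual of `L ⊗ L`. Under these identifications `can` is the transpose
of `can†`, and over a field a linear map is bijective exactly when its transpose is. So bijectivity
of the two maps is equivalent. Continuity of `can` is automatic. Its inverse is continuous because a
basis of the finite dimensional `(H / U)*` has preimages under `can†` lying in `L ⊗ L^V` for a
single `V`; thus `can z` on `L^V` determines the component of `z` at `U`. -/

namespace HopfDual

/-! ### Contraction of tensors with functionals -/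

section Contract

variable {K L N : Type*} [Field K] [AddCommGroup L] [Module K L] [AddCommGroup N] [Module K N]

/-- The contraction `L ⊗ N → L` with a functional on `N`. -/
noncomputable def contract (p : N →ₗ[K] K) : L ⊗[K] N →ₗ[K] L :=
  (TensorProduct.rid K L).toLinearMap ∘ₗ p.lTensor L

@[simp] theorem contract_tmul (p : N →ₗ[K] K) (x : L) (n : N) :
    contract p (x ⊗ₜ[K] n) = p n • x := by
  simp [contract]

theorem contract_lTensor {M : Type*} [AddCommGroup M] [Module K M] (p : N →ₗ[K] K)
    (φ : M →ₗ[K] N) (t : L ⊗[K] M) : contract p (φ.lTensor L t) = contract (p ∘ₗ φ) t := by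
  simp [contract, LinearMap.lTensor_comp]

/-- The functionals on `L` separate points too, and following a contraction by such a functional
gives a product functional, so `pair_ext` applies. -/
theorem contract_ext {J : Type*} (q : J → N →ₗ[K] K) (hq : ∀ n, (∀ j, q j n = 0) → n = 0)
    {z w : L ⊗[K] N} (h : ∀ j, contract (q j) z = contract (q j) w) : z = w := by
  refine pair_ext (fun φ : Module.Dual K L => φ) q
    (fun m hm => (Module.forall_dual_apply_eq_zero_iff K m).1 hm) hq z w fun φ j => ?_
  have key : ∀ t : L ⊗[K] N, pair φ (q j) t = φ (contract (q j) t) := by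
    intro t
    induction t with
    | zero => simp
    | add x y hx hy => simp only [map_add, hx, hy]
    | tmul x y => simp [mul_comm]
  rw [key, key, h]

/-- With `t = ρ x`, this identifies one side of coassociativity with the iterated action `h · (k ·
x)`. -/
theorem contract_pair_assoc_rTensor {C : Type*} [AddCommGroup C] [Module K C] (p : N →ₗ[K] K)
    (q : C →ₗ[K] K) (ρ : L →ₗ[K] L ⊗[K] N) (t : L ⊗[K] C) :
    contract (pair p q) (TensorProduct.assoc K L N C (ρ.rTensor C t)) =
      contract p (ρ (contract q t)) := by
  induction t with
  | zero => simp
  | add x y hx hy => simp only [map_add, hx, hy]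
  | tmul x c =>
    simp only [LinearMap.rTensor_tmul, contract_tmul, map_smul]
    induction ρ x with
    | zero => simp
    | add x y hx hy => simp only [map_add, TensorProduct.add_tmul, smul_add, hx, hy]
    | tmul y n => simp [mul_smul, smul_comm (q c)]

/-- The product of `A*` is convolution, so contracting a product splits along the comultiplication
of `a`; this is the source of the rule `h · (x y) = (h₁ · x) (h₂ · y)`. -/
theorem contract_ev_mul {A L : Type*} [Ring A] [Bialgebra K A] [Ring L] [Algebra K L] {ι : Type*}
    (a : A) (r : Coalgebra.Repr K a ι) (s t : L ⊗[K] D K A) :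
    contract (ev a) (s * t) =
      ∑ i ∈ r.index, contract (ev (r.left i)) s * contract (ev (r.right i)) t := by
  induction s with
  | zero => simp
  | add x y hx hy => simp only [add_mul, map_add, hx, hy, Finset.sum_add_distrib]
  | tmul x f =>
    induction t with
    | zero => simp
    | add x y hx hy => simp only [mul_add, map_add, hx, hy, Finset.sum_add_distrib]
    | tmul y g =>
      simp only [Algebra.TensorProduct.tmul_mul_tmul, contract_tmul, ev_mul a r, Finset.sum_smul]
      exact Finset.sum_congr rfl fun i _ => (smul_mul_smul_comm _ _ _ _).symm

end Contract

end HopfDual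

namespace ProartinianHopfAlgebra

open HopfDual

variable {K : Type u} {H : Type v} [Field K] [AddCommGroup H] [Module K H]
  [TopologicalSpace H] [IsTopologicalAddGroup H] (P : ProartinianHopfAlgebra K H)

/-! ### The evaluation pairing separates points and exchanges structure maps -/

section Eval

theorem eval_separating (z : P.RestrictedDual) (h : ∀ x, P.eval x z = 0) : z = 0 := by
  obtain ⟨U, f, rfl⟩ := P.exists_ι z
  rw [ev_separating f, map_zero]
  intro a
  obtain ⟨x, rfl⟩ := P.proj_surjective U a
  exact h x

theorem eval_comp_ι (x : H) (U : P.Λ) :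
    P.eval x ∘ₗ (P.ι U).toLinearMap = ev (P.proj U x) := rfl

theorem eval_apply_one (U : P.Λ) (x : H) :
    P.eval x (1 : P.RestrictedDual) = counit (P.proj U x) := by
  rw [← map_one (P.ι U), eval_ι, ev_one]

theorem eval_one : P.eval P.one = counit := by
  refine LinearMap.ext fun z => ?_
  obtain ⟨U, f, rfl⟩ := P.exists_ι z
  rw [eval_ι, proj_one]
  rfl

/-- Duality between the comultiplication of `H†` and the multiplication of `H`, reduced to a single
quotient `H / U`. -/
theorem pair_eval_comp_comul (h k : H) :
    pair (P.eval h) (P.eval k) ∘ₗ comul = P.eval (P.mul h k) := by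
  refine LinearMap.ext fun z => ?_
  obtain ⟨U, f, rfl⟩ := P.exists_ι z
  have key : ∀ t : D K (P.Q U) ⊗[K] D K (P.Q U), pair (P.eval h) (P.eval k)
      (TensorProduct.map (P.ι U).toLinearMap (P.ι U).toLinearMap t) =
      pair (ev (P.proj U h)) (ev (P.proj U k)) t := by
    intro t
    induction t with
    | zero => simp
    | add x y hx hy => simp only [map_add, hx, hy]
    | tmul x y => simp
  change pair (P.eval h) (P.eval k) (P.comulR (P.ι U f)) = _
  rw [comulR_ι, key, comul_eq, pair_comulD, eval_ι, proj_mul]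

theorem pair_eval_separating (z : P.RestrictedDual ⊗[K] P.RestrictedDual)
    (h : ∀ x : H × H, pair (P.eval x.1) (P.eval x.2) z = 0) : z = 0 :=
  pair_separating _ _ P.eval_separating P.eval_separating z fun i j => h (i, j)

end Eval

/-! ### Comodules and discrete modules -/

section Module

variable {P} {L : Type w} [AddCommGroup L] [Module K L]

theorem actionOfCoaction_eq_contract (ρ : L →ₗ[K] L ⊗[K] P.RestrictedDual) (h : H) (x : L) :
    P.actionOfCoaction ρ h x = contract (P.eval h) (ρ x) := rfl

theorem actionOfCoaction_injective :
    Function.Injective (P.actionOfCoaction (L := L)) := fun _ _ e =>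
  LinearMap.ext fun x => contract_ext P.eval P.eval_separating fun h =>
    LinearMap.congr_fun (LinearMap.congr_fun e h) x

/-- The counit axiom is literally the unit axiom of the action. The two sides of coassociativity
have contractions `h · (k · x)` and `(h k) · x`, and these contractions determine an element of `L ⊗
(H† ⊗ H†)`. -/
theorem isComodule_iff (ρ : L →ₗ[K] L ⊗[K] P.RestrictedDual) :
    IsComodule ρ ↔ (∀ x, P.actionOfCoaction ρ P.one x = x) ∧
      ∀ h k x, P.actionOfCoaction ρ (P.mul h k) x =
        P.actionOfCoaction ρ h (P.actionOfCoaction ρ k x) := by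
  have h1 : ∀ x, P.actionOfCoaction ρ P.one x =
      ((TensorProduct.rid K L).toLinearMap ∘ₗ counit.lTensor L ∘ₗ ρ) x := fun x => by
    rw [actionOfCoaction_eq_contract, eval_one]
    rfl
  have h2 : ∀ h k x, P.actionOfCoaction ρ (P.mul h k) x =
      contract (pair (P.eval h) (P.eval k)) ((comul.lTensor L ∘ₗ ρ) x) := fun h k x => by
    rw [actionOfCoaction_eq_contract, LinearMap.comp_apply, contract_lTensor,
      pair_eval_comp_comul]
  have h3 : ∀ h k x, P.actionOfCoaction ρ h (P.actionOfCoaction ρ k x) =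
      contract (pair (P.eval h) (P.eval k))
        (((TensorProduct.assoc K L _ _).toLinearMap ∘ₗ ρ.rTensor _ ∘ₗ ρ) x) := fun h k x =>
    (contract_pair_assoc_rTensor _ _ ρ (ρ x)).symm
  simp only [h1, h2, h3]
  refine ⟨fun h => ⟨fun x => by rw [h.counit]; rfl, fun _ _ _ => by rw [h.coassoc]⟩,
    fun h => ⟨?_, LinearMap.ext h.1⟩⟩
  refine LinearMap.ext fun x => contract_ext
    (fun a : H × H => pair (P.eval a.1) (P.eval a.2)) P.pair_eval_separating fun a => ?_
  exact (h.2 a.1 a.2 x).symm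

/-- A tensor is a finite sum of terms `x ⊗ ι f` with `f` in some `(H / U)*`; each is killed by its
`U`, and finitely many such `U` have a common refinement in `Λ`. -/
theorem exists_forall_contract_eval_eq_zero (t : L ⊗[K] P.RestrictedDual) :
    ∃ U : P.Λ, ∀ h ∈ (U : Submodule K H), contract (P.eval h) t = 0 := by
  induction t with
  | zero => exact ⟨Classical.arbitrary _, fun h _ => map_zero _⟩
  | add x y hx hy =>
    obtain ⟨U, hU⟩ := hx
    obtain ⟨V, hV⟩ := hy
    obtain ⟨W, hWU, hWV⟩ := P.exists_le_le U V
    exact ⟨W, fun h hh => by rw [map_add, hU h (hWU hh), hV h (hWV hh), add_zero]⟩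
  | tmul x z =>
    obtain ⟨U, f, rfl⟩ := P.exists_ι z
    refine ⟨U, fun h hh => ?_⟩
    rw [contract_tmul, eval_ι, P.proj_eq_zero.2 hh]
    have : ev (K := K) (0 : P.Q U) f = 0 := map_zero f.ofConv
    rw [this, zero_smul]

theorem exists_mem_fixed_actionOfCoaction (ρ : L →ₗ[K] L ⊗[K] P.RestrictedDual) (x : L) :
    ∃ U, x ∈ P.fixed (P.actionOfCoaction ρ) U :=
  exists_forall_contract_eval_eq_zero (ρ x)

theorem continuous_of_exists_mem_fixed {α : H →ₗ[K] L →ₗ[K] L}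
    (hα : ∀ x, ∃ U, x ∈ P.fixed α U) :
    letI : TopologicalSpace L := ⊥; Continuous fun p : H × L => α p.1 p.2 := by
  let _ : TopologicalSpace L := ⊥
  have : DiscreteTopology L := ⟨rfl⟩
  -- As `L` is discrete, continuity is checked for each fixed `x`; by additivity, at `0` only, where
  -- the map vanishes on an open `U`.
  refine continuous_prod_of_discrete_right.2 fun x => ?_
  obtain ⟨U, hU⟩ := hα x
  refine continuous_of_continuousAt_zero (α.flip x) ?_
  rw [ContinuousAt, map_zero]
  refine tendsto_nhds_of_eventually_eq ?_
  exact Filter.mem_of_superset (P.hasBasis.mem_of_mem U.2) fun h hh => hU h hh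

variable (P) in
-- This is where finite dimensionality of `H / U` enters: with a basis `b i` and dual basis `b i*`,
-- the tensor `∑ (b i · x) ⊗ b i*` represents `q ↦ q · x`.
theorem exists_tensor_act (α : H →ₗ[K] L →ₗ[K] L) {U : P.Λ} (x : P.fixed α U) :
    ∃ t : L ⊗[K] D K (P.Q U), (∀ q, P.act α U q x = contract (ev q) t) ∧
      ∀ h, α h x = contract (P.eval h) ((P.ι U).toLinearMap.lTensor L t) := by
  let b := Module.finBasis K (P.Q U)
  have key : ∀ q, P.act α U q x =
      contract (ev q) (∑ i, P.act α U (b i) x ⊗ₜ[K] ofDual K (P.Q U) (b.coord i)) := fun q => by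
    conv_lhs => rw [← b.sum_repr q, map_sum, LinearMap.sum_apply]
    simp
  refine ⟨_, key, fun h => ?_⟩
  rw [contract_lTensor, eval_comp_ι, ← key, act_proj]

theorem IsDiscreteModule.exists_coaction {α : H →ₗ[K] L →ₗ[K] L} (hα : P.IsDiscreteModule α) :
    ∃ ρ : L →ₗ[K] L ⊗[K] P.RestrictedDual, P.actionOfCoaction ρ = α := by
  have hex : ∀ x : L, ∃ z : L ⊗[K] P.RestrictedDual, ∀ h, contract (P.eval h) z = α h x := by
    intro x
    obtain ⟨U, hU⟩ := hα.exists_mem_fixed x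
    obtain ⟨t, -, ht⟩ := P.exists_tensor_act α ⟨x, hU⟩
    exact ⟨_, fun h => (ht h).symm⟩
  choose ρ hρ using hex
  -- The elements `ρ x` are chosen without regard to linearity, but each is determined by its
  -- contractions, which are linear in `x`.
  refine ⟨⟨⟨ρ, fun x y => ?_⟩, fun c x => ?_⟩, LinearMap.ext fun h => LinearMap.ext fun x => hρ x h⟩
  · exact contract_ext P.eval P.eval_separating fun h => by simp [hρ]
  · exact contract_ext P.eval P.eval_separating fun h => by simp [hρ]

theorem isComodule_iff_isDiscreteModule (ρ : L →ₗ[K] L ⊗[K] P.RestrictedDual) :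
    IsComodule ρ ↔ P.IsDiscreteModule (P.actionOfCoaction ρ) :=
  (isComodule_iff ρ).trans
    ⟨fun h => ⟨continuous_of_exists_mem_fixed (exists_mem_fixed_actionOfCoaction ρ), h.1, h.2⟩,
      fun h => ⟨h.one_act, h.mul_act⟩⟩

end Module

/-! ### Comodule algebras and discrete module algebras -/

section ModuleAlgebra

variable {P} {L : Type w} [Ring L] [Algebra K L]

theorem map_one_iff (ρ : L →ₗ[K] L ⊗[K] P.RestrictedDual) :
    ρ 1 = 1 ↔ ∀ (U : P.Λ) (h : H),
      P.actionOfCoaction ρ h 1 = algebraMap K L (counit (P.proj U h)) := by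
  have h1 : ∀ (U : P.Λ) (h : H), algebraMap K L (counit (P.proj U h)) =
      contract (P.eval h) (1 : L ⊗[K] P.RestrictedDual) := fun U h => by
    rw [Algebra.TensorProduct.one_def, contract_tmul, P.eval_apply_one U,
      Algebra.algebraMap_eq_smul_one]
  simp only [h1]
  exact ⟨fun h U k => by rw [actionOfCoaction_eq_contract, h],
    -- The counit of `proj U h` does not depend on `U`, so any one `U` suffices.
    fun h => contract_ext P.eval P.eval_separating (h (Classical.arbitrary _))⟩

/-- Both `ρ x` and `ρ y` come from `L ⊗ (H / U)*`, and `(H / U)* → H†` is multiplicative, so the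
product is computed at the finite level by `contract_ev_mul`. -/
theorem contract_eval_mul (ρ : L →ₗ[K] L ⊗[K] P.RestrictedDual) (U : P.Λ) (h : H)
    (x y : P.fixed (P.actionOfCoaction ρ) U) :
    contract (P.eval h) (ρ x * ρ y) =
      LinearMap.mul' K L (TensorProduct.map ((P.act (P.actionOfCoaction ρ) U).flip x)
        ((P.act (P.actionOfCoaction ρ) U).flip y) (comul (P.proj U h))) := by
  obtain ⟨s, hs, hs'⟩ := P.exists_tensor_act _ x
  obtain ⟨t, ht, ht'⟩ := P.exists_tensor_act _ y
  have hx : ρ x = (P.ι U).toLinearMap.lTensor L s := contract_ext P.eval P.eval_separating hs'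
  have hy : ρ y = (P.ι U).toLinearMap.lTensor L t := contract_ext P.eval P.eval_separating ht'
  have hmul : (P.ι U).toLinearMap.lTensor L s * (P.ι U).toLinearMap.lTensor L t =
      (P.ι U).toLinearMap.lTensor L (s * t) :=
    (map_mul (Algebra.TensorProduct.map (AlgHom.id K L) (P.ι U)) s t).symm
  rw [hx, hy, hmul, contract_lTensor, eval_comp_ι, contract_ev_mul _ (ℛ K (P.proj U h)),
    ← (ℛ K (P.proj U h)).eq]
  simp only [map_sum, TensorProduct.map_tmul, LinearMap.mul'_apply, LinearMap.flip_apply, hs, ht]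

theorem map_mul_iff (ρ : L →ₗ[K] L ⊗[K] P.RestrictedDual) :
    (∀ x y, ρ (x * y) = ρ x * ρ y) ↔
      ∀ (U : P.Λ) (h : H) (x y : P.fixed (P.actionOfCoaction ρ) U),
        P.actionOfCoaction ρ h (x * y) =
          LinearMap.mul' K L (TensorProduct.map ((P.act (P.actionOfCoaction ρ) U).flip x)
            ((P.act (P.actionOfCoaction ρ) U).flip y) (comul (P.proj U h))) := by
  simp only [← contract_eval_mul]
  refine ⟨fun h U k x y => by rw [actionOfCoaction_eq_contract, h], fun h x y => ?_⟩
  -- The module algebra rule only concerns two elements of the same `L^W`; a common refinement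
  -- provides one for arbitrary `x` and `y`.
  obtain ⟨U, hU⟩ := exists_mem_fixed_actionOfCoaction ρ x
  obtain ⟨V, hV⟩ := exists_mem_fixed_actionOfCoaction ρ y
  obtain ⟨W, hWU, hWV⟩ := P.exists_le_le U V
  exact contract_ext P.eval P.eval_separating fun k =>
    h W k ⟨x, P.fixed_mono _ hWU hU⟩ ⟨y, P.fixed_mono _ hWV hV⟩

theorem isComoduleAlgebra_iff_isDiscreteModuleAlgebra (ρ : L →ₗ[K] L ⊗[K] P.RestrictedDual) :
    IsComoduleAlgebra ρ ↔ P.IsDiscreteModuleAlgebra (P.actionOfCoaction ρ) :=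
  ⟨fun h => ⟨(isComodule_iff_isDiscreteModule ρ).1 h.toIsComodule, (map_one_iff ρ).1 h.map_one,
      (map_mul_iff ρ).1 h.map_mul⟩,
    fun h => ⟨(isComodule_iff_isDiscreteModule ρ).2 h.toIsDiscreteModule,
      (map_one_iff ρ).2 h.act_one, (map_mul_iff ρ).2 h.act_mul⟩⟩

end ModuleAlgebra

end ProartinianHopfAlgebra

namespace HopfDual

/-! ### The isomorphism of `L ⊗ A` with `Hom(A*, L)` for finite dimensional `A` -/

section TensorDual

variable {K : Type*} [Field K] {A : Type*} [Ring A] [Bialgebra K A] {L : Type*} [Field L]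
  [Algebra K L]

variable (K A L) in
/-- The canonical map `L ⊗ A → Hom(A*, L)`, `x ⊗ a ↦ (f ↦ f(a) x)`. -/
noncomputable def tensorToHom : L ⊗[K] A →ₗ[K] D K A →ₗ[K] L :=
  TensorProduct.lift (LinearMap.mk₂ K (fun x a => (ev a).smulRight x)
    (fun x y a => LinearMap.ext fun f => smul_add _ x y)
    (fun c x a => LinearMap.ext fun f => smul_comm _ c x)
    (fun x a b => LinearMap.ext fun f => by simp [ev_add, add_smul])
    (fun c x a => LinearMap.ext fun f => by simp [ev_smul, mul_smul]))

@[simp] theorem tensorToHom_tmul (x : L) (a : A) (f : D K A) :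
    tensorToHom K A L (x ⊗ₜ a) f = ev a f • x := rfl

theorem tensorToHom_baseChange {B : Type*} [Ring B] [Bialgebra K B] (φ : A →ₐc[K] B)
    (t : L ⊗[K] A) (f : D K B) :
    tensorToHom K B L ((φ : A →ₗ[K] B).baseChange L t) f = tensorToHom K A L t (mapD φ f) := by
  induction t with
  | zero => simp
  | add x y hx hy => simp only [map_add, LinearMap.add_apply, hx, hy]
  | tmul x a => rfl

variable [Module.Finite K A]

instance : Module.Finite K (D K A) := Module.Finite.equiv (ofDual K A)

theorem tensorToHom_injective : Function.Injective (tensorToHom K A L) := by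
  refine (injective_iff_map_eq_zero _).2 fun t ht => ?_
  let b := Module.finBasis K A
  obtain ⟨c, rfl⟩ := TensorProduct.eq_repr_basis_right b t
  have hc : ∀ i, c i = 0 := fun i => by
    have := LinearMap.congr_fun ht (ofDual K A (b.coord i))
    simpa [Finsupp.sum_fintype, Finsupp.single_apply] using this
  simp [Finsupp.sum, hc]

theorem tensorToHom_surjective : Function.Surjective (tensorToHom K A L) := by
  intro g
  let b := Module.finBasis K A
  refine ⟨∑ i, g (ofDual K A (b.coord i)) ⊗ₜ b i, LinearMap.ext fun f => ?_⟩
  -- Expansion of `f` in the dual basis; it shows that `g` is determined by its values there.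
  have hf : f = ∑ i, ev (b i) f • ofDual K A (b.coord i) := D_ext fun a => by
    conv_lhs => rw [← b.sum_repr a, ev_sum]
    simp [ev_smul, mul_comm]
  conv_rhs => rw [hf]
  simp

end TensorDual

end HopfDual

/-! ### The map `can` as the transpose of `can†` -/

namespace ProartinianHopfAlgebra

open HopfDual

variable {K : Type u} {H : Type v} [Field K] [AddCommGroup H] [Module K H]
  [TopologicalSpace H] [IsTopologicalAddGroup H] {P : ProartinianHopfAlgebra K H}
  {L : Type w} [Field L] [Algebra K L]

/-- The functional on `L ⊗ H†` attached to an element of `L ^⊗ H`, as a map `H† → L`. -/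
noncomputable def completedTensorToHom (z : P.CompletedTensor L) : P.RestrictedDual →ₗ[K] L :=
  P.liftD (fun U => tensorToHom K (P.Q U) L (z.1 U)) fun U V h f => by
    rw [← tensorToHom_baseChange, z.2 U V h]

theorem completedTensorToHom_ι (z : P.CompletedTensor L) (U : P.Λ) (f : D K (P.Q U)) :
    completedTensorToHom z (P.ι U f) = tensorToHom K (P.Q U) L (z.1 U) f := rfl

/-- Passing to the limit in `L ⊗ H / U ≅ Hom((H / U)*, L)`: compatible families on the left are
exactly linear maps out of the colimit `H†`. -/
theorem completedTensorToHom_bijective :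
    Function.Bijective (completedTensorToHom (P := P) (L := L)) := by
  constructor
  · intro z w h
    refine Subtype.ext (funext fun U => tensorToHom_injective (LinearMap.ext fun f => ?_))
    exact LinearMap.congr_fun h (P.ι U f)
  · intro g
    choose z hz using fun U : P.Λ => tensorToHom_surjective (g ∘ₗ (P.ι U).toLinearMap)
    refine ⟨⟨z, fun U V h => tensorToHom_injective (LinearMap.ext fun f => ?_)⟩,
      LinearMap.ext fun y => ?_⟩
    · rw [tensorToHom_baseChange, hz, hz]
      exact congrArg g (P.ι_trans h f)
    · obtain ⟨U, f, rfl⟩ := P.exists_ι y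
      exact LinearMap.congr_fun (hz U) f

/-- The space `L ^⊗ H` is the `L`-dual of `L ⊗ H†`. -/
noncomputable def completedTensorToDual (z : P.CompletedTensor L) :
    Module.Dual L (L ⊗[K] P.RestrictedDual) :=
  LinearMap.liftBaseChangeEquiv L (completedTensorToHom z)

theorem completedTensorToDual_bijective :
    Function.Bijective (completedTensorToDual (P := P) (L := L)) :=
  (LinearMap.liftBaseChangeEquiv L).bijective.comp completedTensorToHom_bijective

variable {ρ : L →ₗ[K] L ⊗[K] P.RestrictedDual}

/-- The heart of the transposition: evaluating the functional of `z` on `ρ y` is letting the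
component of `z` at `U` act on `y`. Both sides reduce to the pairing of `L ⊗ H / U` with `L ⊗ (H /
U)*`. -/
theorem completedTensorToDual_coaction (z : P.CompletedTensor L) (U : P.Λ)
    (y : P.fixed (P.actionOfCoaction ρ) U) :
    completedTensorToDual z (ρ y) = P.canQ (P.actionOfCoaction ρ) U (z.1 U) y := by
  obtain ⟨t, ht, ht'⟩ := P.exists_tensor_act _ y
  have hy : ρ y = (P.ι U).toLinearMap.lTensor L t := contract_ext P.eval P.eval_separating ht'
  have key : ∀ (s : L ⊗[K] P.Q U) (t : L ⊗[K] D K (P.Q U)),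
      (∀ q, P.act (P.actionOfCoaction ρ) U q y = contract (ev q) t) →
      LinearMap.liftBaseChangeEquiv L (tensorToHom K (P.Q U) L s) t =
        P.canQ (P.actionOfCoaction ρ) U s y := by
    intro s t ht
    induction s with
    | zero => simp
    | add a b ha hb => simp only [map_add, LinearMap.add_apply, ← ha, ← hb]
    | tmul x q =>
      rw [canQ_tmul, ht]
      clear ht
      induction t with
      | zero => simp
      | add a b ha hb => simp only [map_add, ha, hb, mul_add]
      | tmul y f => simp [mul_comm]
  rw [← key _ t ht, hy]
  clear ht ht' hy
  induction t with
  | zero => simp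
  | add a b ha hb => simp only [map_add, ha, hb]
  | tmul x f => rfl

/-- An `L`-linear functional on `L ⊗ L` is determined on the elements `1 ⊗ y`, which `can†` sends to
`ρ y`. -/
theorem liftBaseChange_can (hα : P.IsDiscreteModule (P.actionOfCoaction ρ))
    (z : P.CompletedTensor L) :
    LinearMap.liftBaseChangeEquiv L (can hα z) =
      (coactionCan ρ).dualMap (completedTensorToDual z) := by
  apply (LinearMap.liftBaseChangeEquiv (R := K) (M := L) (N := L) L).symm.injective
  rw [LinearEquiv.symm_apply_apply]
  refine LinearMap.ext fun y => ?_
  obtain ⟨U, hU⟩ := hα.exists_mem_fixed y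
  refine (can_apply hα z U ⟨y, hU⟩).trans ?_
  rw [← completedTensorToDual_coaction]
  simp [coactionCan]

theorem can_bijective_iff (hα : P.IsDiscreteModule (P.actionOfCoaction ρ)) :
    Function.Bijective (can hα) ↔ Function.Bijective (coactionCan ρ) := by
  rw [← LinearMap.dualMap_bijective_iff (f := coactionCan ρ),
    ← (LinearMap.liftBaseChangeEquiv (R := K) (M := L) (N := L) L).comp_bijective,
    ← completedTensorToDual_bijective.of_comp_iff]
  exact iff_of_eq (congrArg _ (funext (liftBaseChange_can hα)))

/-! ### Continuity of `can` and of its inverse -/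

theorem continuous_can {α : H →ₗ[K] L →ₗ[K] L} (hα : P.IsDiscreteModule α) :
    letI := P.endTopology α
    Continuous (can hα) := by
  let _ := P.endTopology α
  refine continuous_iInf_rng.2 fun U => continuous_induced_rng.2 ?_
  -- The restriction of `can z` to `L^U` depends only on the component of `z` at `U`, and any map
  -- out of a discrete space is continuous.
  have h : (fun f : L →ₗ[K] L => f.domRestrict (P.fixed α U)) ∘ can hα =
      (fun t => (P.canQ α U t)) ∘ fun z : P.CompletedTensor L => z.1 U :=
    funext fun z => LinearMap.ext fun y => can_apply hα z U y
  rw [h]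
  let _ : TopologicalSpace (L ⊗[K] P.Q U) := ⊥
  let _ : TopologicalSpace (P.fixed α U →ₗ[K] L) := ⊥
  exact continuous_bot.comp (continuous_iInf_dom (i := U) continuous_induced_dom)

theorem exists_fixed_liftBaseChange_eq_zero {α : H →ₗ[K] L →ₗ[K] L} (hα : P.IsDiscreteModule α)
    (t : L ⊗[K] L) : ∃ V : P.Λ, ∀ f : L →ₗ[K] L, (∀ y ∈ P.fixed α V, f y = 0) →
      f.liftBaseChange L t = 0 := by
  induction t with
  | zero => exact ⟨Classical.arbitrary _, fun f _ => map_zero _⟩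
  | add x y hx hy =>
    obtain ⟨U, hU⟩ := hx
    obtain ⟨V, hV⟩ := hy
    obtain ⟨W, hWU, hWV⟩ := P.exists_le_le U V
    refine ⟨W, fun f hf => ?_⟩
    rw [map_add, hU f fun y hy => hf y (P.fixed_mono α hWU hy),
      hV f fun y hy => hf y (P.fixed_mono α hWV hy), add_zero]
  | tmul x y =>
    obtain ⟨V, hV⟩ := hα.exists_mem_fixed y
    exact ⟨V, fun f hf => by simp [hf y hV]⟩

/-- The quantitative form of continuity of the inverse at `0`. A component at `U` is zero if its
functional vanishes on a basis of `(H / U)*`; those values are values of `can z`, extended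
`L`-linearly, at finitely many elements of `L ⊗ L`, which involve only finitely many elements of
`L`. -/
theorem exists_fixed_imp_component_eq_zero (hα : P.IsDiscreteModule (P.actionOfCoaction ρ))
    (hρ : Function.Surjective (coactionCan ρ)) (U : P.Λ) :
    ∃ V : P.Λ, ∀ z : P.CompletedTensor L,
      (∀ y ∈ P.fixed (P.actionOfCoaction ρ) V, can hα z y = 0) → z.1 U = 0 := by
  let b := Module.finBasis K (D K (P.Q U))
  choose t ht using fun i => hρ (1 ⊗ₜ P.ι U (b i))
  choose V hV using fun i => exists_fixed_liftBaseChange_eq_zero hα (t i)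
  -- An upper bound in the order dual: one `W` in `Λ` contained in all the `V i`.
  obtain ⟨W, hW⟩ := Finite.exists_le fun i => OrderDual.toDual (V i)
  refine ⟨W.ofDual, fun z hz => tensorToHom_injective ?_⟩
  rw [map_zero]
  refine b.ext fun i => ?_
  have h := LinearMap.congr_fun (liftBaseChange_can hα z) (t i)
  rw [LinearMap.dualMap_apply, ht] at h
  have h0 := hV i (can hα z) fun y hy => hz y (P.fixed_mono _ (hW i) hy)
  have h1 : completedTensorToDual z (1 ⊗ₜ P.ι U (b i)) =
      tensorToHom K (P.Q U) L (z.1 U) (b i) := by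
    simp [completedTensorToDual, completedTensorToHom_ι]
  rw [← h1, ← h]
  exact h0

theorem isHomeomorph_can (hα : P.IsDiscreteModule (P.actionOfCoaction ρ))
    (hρ : Function.Bijective (coactionCan ρ)) :
    letI := P.endTopology (P.actionOfCoaction ρ)
    IsHomeomorph (can hα) := by
  let _ := P.endTopology (P.actionOfCoaction ρ)
  let e := LinearEquiv.ofBijective (can hα) ((can_bijective_iff hα).2 hρ)
  refine isHomeomorph_iff_exists_inverse.2
    ⟨continuous_can hα, e.symm, e.symm_apply_apply, e.apply_symm_apply, ?_⟩
  refine continuous_iInf_rng.2 fun U => continuous_induced_rng.2 ?_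
  obtain ⟨V, hV⟩ := exists_fixed_imp_component_eq_zero hα hρ.2 U
  let res : (L →ₗ[K] L) → P.fixed (P.actionOfCoaction ρ) V →ₗ[K] L := fun f => f.domRestrict _
  -- By linearity, the previous vanishing statement says that the component at `U` of the preimage
  -- of `f` depends only on the restriction of `f` to `L^V`.
  have hfac : Function.FactorsThrough (fun f => (e.symm f).1 U) res := fun f g hfg => by
    rw [← sub_eq_zero]
    have : (e.symm (f - g)).1 U = 0 := hV _ fun y hy => by
      have h1 : can hα (e.symm (f - g)) = f - g := e.apply_symm_apply _
      rw [h1, LinearMap.sub_apply, sub_eq_zero]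
      exact LinearMap.congr_fun hfg ⟨y, hy⟩
    rwa [map_sub] at this
  -- The factorization need only be some function on the discrete space `Hom(L^V, L)`; the default
  -- value `0` is irrelevant to its continuity.
  have h : (fun z : P.CompletedTensor L => z.1 U) ∘ e.symm =
      Function.extend res (fun f => (e.symm f).1 U) 0 ∘ res :=
    funext fun f => (hfac.extend_apply 0 f).symm
  rw [h]
  let _ : TopologicalSpace (L ⊗[K] P.Q U) := ⊥
  let _ : TopologicalSpace (P.fixed (P.actionOfCoaction ρ) V →ₗ[K] L) := ⊥
  exact continuous_bot.comp (continuous_iInf_dom (i := V) continuous_induced_dom)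

end ProartinianHopfAlgebra

/-! ### The three statements assembled -/

theorem mainTheorem7 {K : Type u} {H : Type v} [Field K] [AddCommGroup H] [Module K H]
    [TopologicalSpace H] [IsTopologicalAddGroup H] (P : ProartinianHopfAlgebra K H) :
    (∀ (L : Type w) [AddCommGroup L] [Module K L],
      Set.BijOn P.actionOfCoaction
        {ρ : L →ₗ[K] L ⊗[K] P.RestrictedDual | IsComodule ρ}
        {α : H →ₗ[K] L →ₗ[K] L | P.IsDiscreteModule α}) ∧
    (∀ (L : Type w) [Ring L] [Algebra K L],
      Set.BijOn P.actionOfCoaction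
        {ρ : L →ₗ[K] L ⊗[K] P.RestrictedDual | IsComoduleAlgebra ρ}
        {α : H →ₗ[K] L →ₗ[K] L | P.IsDiscreteModuleAlgebra α}) ∧
    (∀ (L : Type w) [Field L] [Algebra K L] (ρ : L →ₗ[K] L ⊗[K] P.RestrictedDual),
      IsComoduleAlgebra ρ →
        (P.IsHGalois (P.actionOfCoaction ρ) ↔ Function.Bijective (coactionCan ρ))) := by
  refine ⟨fun L _ _ =>
    ⟨fun ρ hρ => (ProartinianHopfAlgebra.isComodule_iff_isDiscreteModule ρ).1 hρ,
      ProartinianHopfAlgebra.actionOfCoaction_injective.injOn, fun α hα => ?_⟩, fun L _ _ =>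
    ⟨fun ρ hρ => (ProartinianHopfAlgebra.isComoduleAlgebra_iff_isDiscreteModuleAlgebra ρ).1 hρ,
      ProartinianHopfAlgebra.actionOfCoaction_injective.injOn, fun α hα => ?_⟩,
    fun L _ _ ρ hρ => ⟨?_, fun h => ?_⟩⟩
  · obtain ⟨ρ, rfl⟩ := ProartinianHopfAlgebra.IsDiscreteModule.exists_coaction hα
    exact ⟨ρ, (ProartinianHopfAlgebra.isComodule_iff_isDiscreteModule ρ).2 hα, rfl⟩
  · obtain ⟨ρ, rfl⟩ := ProartinianHopfAlgebra.IsDiscreteModule.exists_coaction hα.toIsDiscreteModule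
    exact ⟨ρ, (ProartinianHopfAlgebra.isComoduleAlgebra_iff_isDiscreteModuleAlgebra ρ).2 hα, rfl⟩
  · rintro ⟨hα, h⟩
    let _ := P.endTopology (P.actionOfCoaction ρ)
    exact (ProartinianHopfAlgebra.can_bijective_iff hα.toIsDiscreteModule).1 h.bijective
  · have hα := (ProartinianHopfAlgebra.isComoduleAlgebra_iff_isDiscreteModuleAlgebra ρ).1 hρ
    exact ⟨hα, ProartinianHopfAlgebra.isHomeomorph_can hα.toIsDiscreteModule h⟩
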